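/- Let $\kappa\ge 1$, let $\psi\colon\mathbb R\to(0,\infty)$ be a continuous even function, let $\rho(x)=\psi(\|x\|)^{-1}$ for $x\in\mathbb R^\kappa$, where $\|\cdot\|$ is the Euclidean norm, and let $\mu_\rho$ be the Borel measure $\mathrm d\mu_\rho=\rho\,\mathrm dx$ on $\mathbb R^\kappa$. For an affine map $T$ of $\mathbb R^\kappa$ with invertible linear part let $C_{T,\rho}$ denote the composition operator $f\mapsto f\circ T$ in the complex space $L^2(\mu_\rho)$. A bounded operator on a complex Hilbert space is called cosubnormal if its adjoint is subnormal, i.e. the adjoint is the restriction of a bounded normal operator on a larger (isometrically containing) complex Hilbert space to an invariant subspace. Let $A$ be an invertible linear transformation of $\mathbb R^\kappa$ and let $a_0\in\ker(I-A)\setminus\{0\}$. Suppose that for every $t\ge 0$ the operator $C_{A+ta_0,\rho}$ (composition with $x\mapsto Ax+ta_0$) is a bounded cosubnormal operator on $L^2(\mu_\rho)$, and that there exists $\varepsilon\in(0,\infty)$ such that $$\sup_{0\le t\le\varepsilon}\|C_{A+ta_0,\rho}\|<\infty .$$ Then $\psi$ is the hyperbolic cosine transform of a compactly supported Borel measure on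 $\mathbb R_+=[0,\infty)$, i.e. there is a (positive) Borel measure $\nu$ on $[0,\infty)$ vanishing off a compact set such that $$\psi(x)=\int_{[0,\infty)}\cosh(xu)\,\mathrm d\nu(u),\qquad x\in\mathbb R .$$ -/

import Mathlib

open MeasureTheory Set
open scoped ENNReal NNReal

noncomputable section

universe u

/-- A bounded operator `S` on a complex Hilbert space `H` is subnormal if it is the restriction of
a bounded normal operator `N`, acting on a Hilbert space `K` into which `H` embeds isometrically. -/
def IsSubnormalOp {H : Type u} [NormedAddCommGroup H] [InnerProductSpace ℂ H]
    (S : H →L[ℂ] H) : Prop :=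
  ∃ (K : Type u) (_ : NormedAddCommGroup K) (_ : InnerProductSpace ℂ K) (_ : CompleteSpace K)
    (J : H →ₗᵢ[ℂ] K) (N : K →L[ℂ] K), IsStarNormal N ∧ ∀ h : H, J (S h) = N (J h)

/-- A bounded operator is cosubnormal if its Hilbert space adjoint is subnormal. -/
def IsCosubnormalOp {H : Type u} [NormedAddCommGroup H] [InnerProductSpace ℂ H] [CompleteSpace H]
    (S : H →L[ℂ] H) : Prop :=
  IsSubnormalOp (ContinuousLinearMap.adjoint S)

section Composition

variable {X : Type u} [MeasurableSpace X]

/-- The bounded operator `C` on `L²(μ)` sends (the class of) every square integrable `f` to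
(the class of) `f ∘ T`. -/
def IsCompositionOp (μ : Measure X) (T : X → X) (C : Lp ℂ 2 μ →L[ℂ] Lp ℂ 2 μ) : Prop :=
  ∀ (f : X → ℂ) (hf : MemLp f 2 μ), C (hf.toLp f) =ᵐ[μ] f ∘ T

/-- `f ↦ f ∘ T` is (a well defined and) bounded operator on the whole of `L²(μ)`. -/
def HasBoundedCompositionOp (μ : Measure X) (T : X → X) : Prop :=
  ∃ C : Lp ℂ 2 μ →L[ℂ] Lp ℂ 2 μ, IsCompositionOp μ T C

open Classical in
/-- The composition operator `f ↦ f ∘ T` on `L²(μ)`, with the value `0` when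
`f ↦ f ∘ T` is not a bounded operator on `L²(μ)`. -/
def compositionOp (μ : Measure X) (T : X → X) : Lp ℂ 2 μ →L[ℂ] Lp ℂ 2 μ :=
  if h : HasBoundedCompositionOp μ T then h.choose else 0

theorem isCompositionOp_compositionOp {μ : Measure X} {T : X → X}
    (h : HasBoundedCompositionOp μ T) : IsCompositionOp μ T (compositionOp μ T) := by
  rw [compositionOp, dif_pos h]
  exact h.choose_spec

theorem IsCompositionOp.eq_compositionOp {μ : Measure X} {T : X → X}
    {C : Lp ℂ 2 μ →L[ℂ] Lp ℂ 2 μ} (hC : IsCompositionOp μ T C) : C = compositionOp μ T := by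
  ext1 f
  have h1 := hC f (Lp.memLp f)
  have h2 := isCompositionOp_compositionOp ⟨C, hC⟩ f (Lp.memLp f)
  rw [Lp.toLp_coeFn] at h1 h2
  exact Lp.ext (h1.trans h2.symm)

end Composition

/-- The Borel measure `ρ(x) dx` on `ℝ^κ` with density `ρ(x) = 1 / ψ(‖x‖)`. -/
def radialMeasure (κ : ℕ) (ψ : ℝ → ℝ) : Measure (EuclideanSpace ℝ (Fin κ)) :=
  (volume : Measure (EuclideanSpace ℝ (Fin κ))).withDensity
    (fun x => ENNReal.ofReal (ψ ‖x‖)⁻¹)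

/-- `ψ` is the hyperbolic cosine transform of the Borel measure `ν` on `[0, ∞)`. -/
def IsCoshTransform (ψ : ℝ → ℝ) (ν : Measure ℝ≥0) : Prop :=
  ∀ x : ℝ, Integrable (fun u : ℝ≥0 => Real.cosh (x * (u : ℝ))) ν ∧
    ψ x = ∫ u : ℝ≥0, Real.cosh (x * (u : ℝ)) ∂ν

/-- A Borel measure is compactly supported if it vanishes off a compact set. -/
def IsCompactlySupported {X : Type u} [TopologicalSpace X] [MeasurableSpace X]
    (ν : Measure X) : Prop :=
  ∃ K : Set X, IsCompact K ∧ ν Kᶜ = 0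

end

/-! Write `T x = A x + t a₀`. The adjoint of the composition operator maps `ψ(‖·‖) 1_E` to `|det
A|⁻¹ ψ(‖·‖) 1_{T E}`, so the squared norms of its iterates on this vector are `|det A|⁻ⁿ ∫_E ψ(‖Tⁿ
x‖) dx`. Subnormality of the adjoint makes them moments of a measure on a bounded interval `[0, R]`,
expressed here as positivity of `momentFunctional`. As `E` is arbitrary and `ψ` continuous, the same
positivity holds pointwise for `n ↦ ψ(‖Tⁿ x‖)`. Since `A a₀ = a₀`, points on the line `ℝ a₀` give it
for `n ↦ ψ(s + n t)`, for all real `s` and all `t ≥ 0` (`HasStieltjesSamples`).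

The rest is about functions on `ℝ`. Step `t = 1` bounds `ψ` exponentially, and this growth confines
the positivity condition for step `t` to `[e^{-Lt}, e^{Lt}]` with `L` independent of `t`. Hence
`e^{qx} ↦ ψ(q)`, `q` rational, is positive on exponential sums over `[-L, L]`. Riesz extension and
Riesz–Markov give `ψ(x) = ∫ e^{xu} dμ(u)`; evenness turns this into a cosh transform of the image of
`μ` under `u ↦ |u|`. -/

/-! ### Moment functionals on polynomials. -/

open Polynomial in
/-- The linear functional on real polynomials sending `X ^ n` to `a n`. -/
noncomputable def momentFunctional (a : ℕ → ℝ) : ℝ[X] →ₗ[ℝ] ℝ :=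
  Polynomial.lsum fun n => a n • LinearMap.id

open Polynomial in
theorem momentFunctional_monomial (a : ℕ → ℝ) (n : ℕ) (c : ℝ) :
    momentFunctional a (monomial n c) = c * a n := by
  simp [momentFunctional, Polynomial.lsum_apply, Polynomial.sum_monomial_index, mul_comm]

open Polynomial in
theorem momentFunctional_eq_sum (a : ℕ → ℝ) (p : ℝ[X]) :
    momentFunctional a p = p.sum fun n c => c * a n := by
  simp [momentFunctional, Polynomial.lsum_apply, mul_comm]

open Polynomial in
theorem momentFunctional_X_pow (a : ℕ → ℝ) (n : ℕ) :
    momentFunctional a (X ^ n) = a n := by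
  rw [← monomial_one_right_eq_X_pow, momentFunctional_monomial, one_mul]

open Polynomial in
theorem momentFunctional_C (a : ℕ → ℝ) (c : ℝ) :
    momentFunctional a (C c) = c * a 0 := by
  rw [← monomial_zero_left, momentFunctional_monomial]

open Polynomial in
theorem momentFunctional_C_mul (a : ℕ → ℝ) (c : ℝ) (p : ℝ[X]) :
    momentFunctional a (C c * p) = c * momentFunctional a p := by
  rw [← smul_eq_C_mul, map_smul, smul_eq_mul]

open Polynomial in
theorem momentFunctional_X_pow_mul (a : ℕ → ℝ) (m : ℕ) (p : ℝ[X]) :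
    momentFunctional a (X ^ m * p) = momentFunctional (fun n => a (n + m)) p := by
  induction p using Polynomial.induction_on' with
  | add p q hp hq => rw [mul_add, map_add, map_add, hp, hq]
  | monomial n c => rw [X_pow_mul_monomial, momentFunctional_monomial, momentFunctional_monomial]

open Polynomial in
theorem momentFunctional_comp_C_mul_X (a : ℕ → ℝ) (d : ℝ) (p : ℝ[X]) :
    momentFunctional a (p.comp (C d * X)) = momentFunctional (fun n => d ^ n * a n) p := by
  induction p using Polynomial.induction_on' with
  | add p q hp hq => rw [add_comp, map_add, map_add, hp, hq]
  | monomial n c =>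
    rw [monomial_comp, mul_pow, ← C_pow, ← mul_assoc, ← C_mul, momentFunctional_C_mul,
      momentFunctional_X_pow, momentFunctional_monomial, mul_assoc]

/-! ### Moment positivity for normal and subnormal operators. -/

section Operator

variable {H : Type*} [NormedAddCommGroup H] [InnerProductSpace ℂ H]

open ContinuousLinearMap Polynomial in
theorem re_inner_aeval_adjoint_mul_self [CompleteSpace H] {N : H →L[ℂ] H} (hN : IsStarNormal N)
    (p : ℝ[X]) (v : H) :
    (inner ℂ (aeval (star N * N) p v) v).re =
      momentFunctional (fun n => ‖(N ^ n) v‖ ^ 2) p := by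
  induction p using Polynomial.induction_on' with
  | add p q hp hq => simp only [map_add, add_apply, inner_add_left, Complex.add_re, hp, hq]
  | monomial n c =>
    -- Normality gives `(N* N)ⁿ = (Nⁿ)* Nⁿ`.
    rw [momentFunctional_monomial, aeval_monomial, hN.star_comm_self.mul_pow, ← star_pow,
      Algebra.algebraMap_eq_smul_one, smul_mul_assoc, one_mul, smul_apply, ← Complex.coe_smul,
      inner_smul_left, mul_apply_eq_comp, star_eq_adjoint, adjoint_inner_left]
    rw [← Complex.ofReal_re (‖(N ^ n) v‖ ^ 2)]
    simp

-- The spectrum of `N* N` lies in `[0, ‖N‖²]`, so `p(N* N)` is a positive operator by the functional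
-- calculus.
open ContinuousLinearMap Polynomial in
theorem IsStarNormal.momentFunctional_nonneg [CompleteSpace H] {N : H →L[ℂ] H}
    (hN : IsStarNormal N) {p : ℝ[X]} (hp : ∀ x ∈ Icc 0 (‖N‖ ^ 2), 0 ≤ p.eval x) (v : H) :
    0 ≤ momentFunctional (fun n => ‖(N ^ n) v‖ ^ 2) p := by
  have hpos : 0 ≤ aeval (star N * N) p := by
    have hsa : IsSelfAdjoint (star N * N) := IsSelfAdjoint.star_mul_self N
    rw [← cfc_polynomial p (star N * N) hsa]
    refine cfc_nonneg fun x hx => hp x ⟨?_, ?_⟩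
    · exact spectrum_nonneg_of_nonneg (star_mul_self_nonneg N) hx
    · have h := (spectrum.norm_le_norm_mul_of_mem hx).trans
        (mul_le_of_le_one_right (norm_nonneg _) norm_id_le)
      rw [CStarRing.norm_star_mul_self, ← sq] at h
      exact (le_abs_self x).trans h
  rw [← re_inner_aeval_adjoint_mul_self hN]
  exact ((nonneg_iff_isPositive _).1 hpos).re_inner_nonneg_left v

open Polynomial in
theorem IsSubnormalOp.exists_momentFunctional_nonneg {H : Type u} [NormedAddCommGroup H]
    [InnerProductSpace ℂ H] {S : H →L[ℂ] H} (hS : IsSubnormalOp S) :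
    ∃ R : ℝ, 0 ≤ R ∧ ∀ p : ℝ[X], (∀ x ∈ Icc 0 R, 0 ≤ p.eval x) →
      ∀ f : H, 0 ≤ momentFunctional (fun n => ‖(S ^ n) f‖ ^ 2) p := by
  obtain ⟨K, _, _, _, J, N, hN, hJ⟩ := hS
  refine ⟨‖N‖ ^ 2, by positivity, fun p hp f => ?_⟩
  have h := hN.momentFunctional_nonneg hp (J f)
  have hpow : ∀ n : ℕ, J ((S ^ n) f) = (N ^ n) (J f) := by
    intro n
    induction n with
    | zero => rfl
    | succ n ih => rw [pow_succ', pow_succ', mul_apply_eq_comp, hJ, ih]; rfl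
  simpa only [← hpow, J.norm_map] using h

end Operator

/-! ### Adjoints of affine composition operators on the weighted space. -/

section Radial

variable {κ : ℕ} {ψ : ℝ → ℝ}

theorem integral_radialMeasure (hψ_pos : ∀ x, 0 < ψ x) (hψ_cont : Continuous ψ)
    {F : Type*} [NormedAddCommGroup F] [NormedSpace ℝ F] (g : EuclideanSpace ℝ (Fin κ) → F) :
    ∫ x, g x ∂radialMeasure κ ψ = ∫ x, (ψ ‖x‖)⁻¹ • g x := by
  rw [radialMeasure, integral_withDensity_eq_integral_toReal_smul
    (by have := hψ_cont.measurable; fun_prop) (by simp)]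
  simp only [ENNReal.toReal_ofReal (inv_nonneg.2 (hψ_pos _).le)]

theorem radialMeasure_lt_top_of_isBounded (hψ_pos : ∀ x, 0 < ψ x) (hψ_cont : Continuous ψ)
    {E : Set (EuclideanSpace ℝ (Fin κ))} (hE : Bornology.IsBounded E) :
    radialMeasure κ ψ E < ∞ := by
  have : IsLocallyFiniteMeasure (radialMeasure κ ψ) :=
    IsLocallyFiniteMeasure.withDensity_ofReal (f := fun x => (ψ ‖x‖)⁻¹)
      ((hψ_cont.comp continuous_norm).inv₀ fun x => (hψ_pos _).ne')
  exact hE.measure_lt_top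

/-- The function `ψ(‖x‖)`, cut off outside `E`. -/
noncomputable def weightIndicator (ψ : ℝ → ℝ) (E : Set (EuclideanSpace ℝ (Fin κ))) :
    EuclideanSpace ℝ (Fin κ) → ℂ :=
  E.indicator fun x => (ψ ‖x‖ : ℂ)

theorem memLp_weightIndicator (hψ_pos : ∀ x, 0 < ψ x) (hψ_cont : Continuous ψ)
    {E : Set (EuclideanSpace ℝ (Fin κ))} (hE : Bornology.IsBounded E) (hEm : MeasurableSet E) :
    MemLp (weightIndicator ψ E) 2 (radialMeasure κ ψ) := by
  have hc : Continuous fun x : EuclideanSpace ℝ (Fin κ) => (ψ ‖x‖ : ℂ) := by fun_prop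
  obtain ⟨B, hB⟩ := hE.isCompact_closure.exists_bound_of_continuousOn hc.continuousOn
  rw [weightIndicator, memLp_indicator_iff_restrict hEm]
  have : IsFiniteMeasure ((radialMeasure κ ψ).restrict E) :=
    ⟨by simpa using radialMeasure_lt_top_of_isBounded hψ_pos hψ_cont hE⟩
  refine MemLp.of_bound hc.aestronglyMeasurable B ?_
  exact ae_restrict_of_forall_mem hEm fun x hx => hB x (subset_closure hx)

/-- The factor `ψ` cancels the density, leaving Lebesgue measure, for which affine changes of
variables are explicit. -/
theorem inner_toLp_weightIndicator (hψ_pos : ∀ x, 0 < ψ x) (hψ_cont : Continuous ψ)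
    {E : Set (EuclideanSpace ℝ (Fin κ))} (hE : Bornology.IsBounded E) (hEm : MeasurableSet E)
    {u : Lp ℂ 2 (radialMeasure κ ψ)} {g : EuclideanSpace ℝ (Fin κ) → ℂ}
    (hg : u =ᵐ[radialMeasure κ ψ] g) :
    inner ℂ ((memLp_weightIndicator hψ_pos hψ_cont hE hEm).toLp) u = ∫ x in E, g x := by
  rw [L2.inner_def]
  have h1 : (fun x => inner ℂ (((memLp_weightIndicator hψ_pos hψ_cont hE hEm).toLp _ : _ → ℂ) x) (u x))
      =ᵐ[radialMeasure κ ψ] fun x => E.indicator (fun x => (ψ ‖x‖ : ℂ) * g x) x := by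
    filter_upwards [hg, (memLp_weightIndicator hψ_pos hψ_cont hE hEm).coeFn_toLp] with x hx1 hx2
    rw [hx1, hx2, weightIndicator]
    by_cases hx : x ∈ E <;> simp [hx, mul_comm]
  rw [integral_congr_ae h1, integral_radialMeasure hψ_pos hψ_cont, ← integral_indicator hEm]
  congr 1
  ext x
  by_cases hx : x ∈ E
  · have := (hψ_pos ‖x‖).ne'
    simp [hx, this]
  · simp [hx]

theorem norm_toLp_weightIndicator_sq (hψ_pos : ∀ x, 0 < ψ x) (hψ_cont : Continuous ψ)
    {E : Set (EuclideanSpace ℝ (Fin κ))} (hE : Bornology.IsBounded E) (hEm : MeasurableSet E) :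
    ‖(memLp_weightIndicator hψ_pos hψ_cont hE hEm).toLp‖ ^ 2 = ∫ x in E, ψ ‖x‖ := by
  have h := inner_toLp_weightIndicator hψ_pos hψ_cont hE hEm
    (memLp_weightIndicator hψ_pos hψ_cont hE hEm).coeFn_toLp
  rw [inner_self_eq_norm_sq_to_K] at h
  have h2 : ∫ x in E, weightIndicator ψ E x = ∫ x in E, (ψ ‖x‖ : ℂ) :=
    setIntegral_congr_fun hEm fun x hx => by simp [weightIndicator, hx]
  rw [h2, integral_complex_ofReal] at h
  exact Complex.ofReal_injective (by rw [← h]; push_cast; rfl)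

section Affine

variable (A : EuclideanSpace ℝ (Fin κ) →ₗ[ℝ] EuclideanSpace ℝ (Fin κ))
  (b : EuclideanSpace ℝ (Fin κ))

theorem continuous_linearMap_add_const : Continuous fun x => A x + b :=
  A.continuous_of_finiteDimensional.add continuous_const

variable {A}

theorem injective_linearMap_add_const (hA : IsUnit A) : Function.Injective fun x => A x + b :=
  fun _ _ h => ((Module.End.isUnit_iff A).1 hA).1 (add_right_cancel h)

theorem isBounded_image_linearMap_add_const {E : Set (EuclideanSpace ℝ (Fin κ))}
    (hE : Bornology.IsBounded E) : Bornology.IsBounded ((fun x => A x + b) '' E) :=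
  ((hE.isCompact_closure.image (continuous_linearMap_add_const A b)).isBounded).subset
    (image_mono subset_closure)

theorem measurableSet_image_linearMap_add_const (hA : IsUnit A)
    {E : Set (EuclideanSpace ℝ (Fin κ))} (hEm : MeasurableSet E) :
    MeasurableSet ((fun x => A x + b) '' E) :=
  hEm.image_of_continuousOn_injOn (continuous_linearMap_add_const A b).continuousOn
    (injective_linearMap_add_const b hA).injOn

theorem setIntegral_image_linearMap_add_const (hA : IsUnit A) {F : Type*} [NormedAddCommGroup F]
    [NormedSpace ℝ F] {E : Set (EuclideanSpace ℝ (Fin κ))} (hEm : MeasurableSet E)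
    (g : EuclideanSpace ℝ (Fin κ) → F) :
    ∫ x in (fun x => A x + b) '' E, g x = |LinearMap.det A| • ∫ x in E, g (A x + b) := by
  rw [integral_image_eq_integral_abs_det_fderiv_smul volume hEm (f := fun x => A x + b)
    (f' := fun _ => LinearMap.toContinuousLinearMap A)
    (fun x _ => ((LinearMap.toContinuousLinearMap A).hasFDerivAt.add_const b).hasFDerivWithinAt)
    (injective_linearMap_add_const b hA).injOn, LinearMap.det_toContinuousLinearMap, integral_smul]

theorem adjoint_toLp_weightIndicator (hψ_pos : ∀ x, 0 < ψ x) (hψ_cont : Continuous ψ)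
    (hA : IsUnit A) {C : Lp ℂ 2 (radialMeasure κ ψ) →L[ℂ] Lp ℂ 2 (radialMeasure κ ψ)}
    (hC : IsCompositionOp (radialMeasure κ ψ) (fun x => A x + b) C)
    {E : Set (EuclideanSpace ℝ (Fin κ))} (hE : Bornology.IsBounded E) (hEm : MeasurableSet E) :
    ContinuousLinearMap.adjoint C (memLp_weightIndicator hψ_pos hψ_cont hE hEm).toLp =
      ((|LinearMap.det A|⁻¹ : ℝ) : ℂ) •
        (memLp_weightIndicator hψ_pos hψ_cont (isBounded_image_linearMap_add_const b hE)
          (measurableSet_image_linearMap_add_const b hA hEm)).toLp := by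
  have hd : |LinearMap.det A| ≠ 0 := abs_ne_zero.2 (LinearMap.isUnit_det A hA).ne_zero
  refine ext_inner_right ℂ fun u => ?_
  have hu := hC u (Lp.memLp u)
  rw [Lp.toLp_coeFn] at hu
  rw [ContinuousLinearMap.adjoint_inner_left, inner_smul_left,
    inner_toLp_weightIndicator hψ_pos hψ_cont hE hEm hu,
    inner_toLp_weightIndicator hψ_pos hψ_cont (isBounded_image_linearMap_add_const b hE)
      (measurableSet_image_linearMap_add_const b hA hEm) (ae_eq_refl u),
    setIntegral_image_linearMap_add_const b hA hEm, Complex.conj_ofReal, Complex.ofReal_inv,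
    Complex.real_smul, inv_mul_cancel_left₀ (Complex.ofReal_ne_zero.2 hd)]
  rfl

theorem norm_adjoint_pow_toLp_weightIndicator_sq (hψ_pos : ∀ x, 0 < ψ x) (hψ_cont : Continuous ψ)
    (hA : IsUnit A) {C : Lp ℂ 2 (radialMeasure κ ψ) →L[ℂ] Lp ℂ 2 (radialMeasure κ ψ)}
    (hC : IsCompositionOp (radialMeasure κ ψ) (fun x => A x + b) C) (n : ℕ)
    {E : Set (EuclideanSpace ℝ (Fin κ))} (hE : Bornology.IsBounded E) (hEm : MeasurableSet E) :
    ‖(ContinuousLinearMap.adjoint C ^ n) (memLp_weightIndicator hψ_pos hψ_cont hE hEm).toLp‖ ^ 2 =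
      |LinearMap.det A|⁻¹ ^ n * ∫ x in E, ψ ‖(fun x => A x + b)^[n] x‖ := by
  have hd : |LinearMap.det A| ≠ 0 := by
    rw [abs_ne_zero]; exact (LinearMap.isUnit_det A hA).ne_zero
  induction n generalizing E with
  | zero => simpa using norm_toLp_weightIndicator_sq hψ_pos hψ_cont hE hEm
  | succ n ih =>
    rw [pow_succ (ContinuousLinearMap.adjoint C), mul_apply_eq_comp,
      adjoint_toLp_weightIndicator b hψ_pos hψ_cont hA hC hE hEm, map_smul, norm_smul, mul_pow,
      ih (isBounded_image_linearMap_add_const b hE)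
        (measurableSet_image_linearMap_add_const b hA hEm), setIntegral_image_linearMap_add_const b hA hEm]
    simp only [Function.iterate_succ_apply, Complex.norm_real, norm_inv, Real.norm_eq_abs, abs_abs,
      smul_eq_mul, pow_succ]
    field_simp

/-- Pointwise form of subnormality of the adjoint. -/
theorem exists_momentFunctional_iterate_nonneg (hψ_pos : ∀ x, 0 < ψ x) (hψ_cont : Continuous ψ)
    (hA : IsUnit A) (hb : HasBoundedCompositionOp (radialMeasure κ ψ) (fun x => A x + b))
    (hcosub : IsCosubnormalOp (compositionOp (radialMeasure κ ψ) (fun x => A x + b))) :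
    ∃ R : ℝ, 0 ≤ R ∧ ∀ p : Polynomial ℝ, (∀ x ∈ Icc 0 R, 0 ≤ p.eval x) →
      ∀ x, 0 ≤ momentFunctional (fun n => ψ ‖(fun x => A x + b)^[n] x‖) p := by
  set T : EuclideanSpace ℝ (Fin κ) → EuclideanSpace ℝ (Fin κ) := fun x => A x + b with hT
  have hTc : Continuous T := continuous_linearMap_add_const A b
  set d := |LinearMap.det A| with hd_def
  have hd : 0 < d := abs_pos.2 (LinearMap.isUnit_det A hA).ne_zero
  obtain ⟨R, hR, hp⟩ := hcosub.exists_momentFunctional_nonneg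
  -- Multiplying the `n`-th moment by `dⁿ` cancels the determinant factor and dilates `[0, R]` by
  -- `d`.
  refine ⟨d * R, by positivity, fun p hpR => ?_⟩
  have hcont : Continuous fun x => momentFunctional (fun n => ψ ‖T^[n] x‖) p := by
    simp only [momentFunctional_eq_sum, Polynomial.sum]
    exact continuous_finsetSum _ fun n _ => continuous_const.mul
      (hψ_cont.comp (hTc.iterate n).norm)
  have hball : ∀ E : Set (EuclideanSpace ℝ (Fin κ)), Bornology.IsBounded E → MeasurableSet E →
      0 ≤ ∫ x in E, momentFunctional (fun n => ψ ‖T^[n] x‖) p := by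
    intro E hE hEm
    have h1 := hp (p.comp (Polynomial.C d * Polynomial.X)) (fun x hx => by
      rw [Polynomial.eval_comp]
      refine hpR _ ?_
      have := hx.1
      simp only [Polynomial.eval_mul, Polynomial.eval_C, Polynomial.eval_X]
      exact ⟨by positivity, by gcongr; exact hx.2⟩)
      (memLp_weightIndicator hψ_pos hψ_cont hE hEm).toLp
    have hmom : ∀ n : ℕ, d ^ n * ‖(ContinuousLinearMap.adjoint
        (compositionOp (radialMeasure κ ψ) T) ^ n)
          (memLp_weightIndicator hψ_pos hψ_cont hE hEm).toLp‖ ^ 2 = ∫ x in E, ψ ‖T^[n] x‖ := by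
      intro n
      rw [norm_adjoint_pow_toLp_weightIndicator_sq b hψ_pos hψ_cont hA
        (isCompositionOp_compositionOp hb) n hE hEm, ← mul_assoc, ← mul_pow, ← hd_def,
        mul_inv_cancel₀ hd.ne', one_pow, one_mul]
    simp only [momentFunctional_comp_C_mul_X, hmom] at h1
    refine h1.trans_eq ?_
    simp only [momentFunctional_eq_sum, Polynomial.sum]
    rw [integral_finsetSum]
    · simp only [integral_const_mul]
    · intro n _
      have hc : Continuous fun x => p.coeff n * ψ ‖T^[n] x‖ :=
        continuous_const.mul (hψ_cont.comp (hTc.iterate n).norm)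
      exact (hc.locallyIntegrable.integrableOn_isCompact hE.isCompact_closure).mono_set
        subset_closure
  intro x₀
  -- A negative value would persist on a ball by continuity, making the integral over it negative.
  by_contra! hneg
  obtain ⟨δ, hδ, hball_neg⟩ := Metric.isOpen_iff.1 (isOpen_lt hcont continuous_const) x₀ hneg
  have h1 := hball (Metric.ball x₀ δ) Metric.isBounded_ball measurableSet_ball
  have hpos : 0 < ∫ x in Metric.ball x₀ δ, -momentFunctional (fun n => ψ ‖T^[n] x‖) p := by
    rw [setIntegral_pos_iff_support_of_nonneg_ae]
    · refine lt_of_lt_of_le (Metric.measure_ball_pos volume x₀ hδ) (measure_mono fun x hx => ⟨?_, hx⟩)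
      exact neg_ne_zero.2 (ne_of_lt (hball_neg hx))
    · exact ae_restrict_of_forall_mem measurableSet_ball fun x hx =>
        neg_nonneg.2 (le_of_lt (hball_neg hx))
    · exact (hcont.neg.locallyIntegrable.integrableOn_isCompact
        (Metric.isBounded_ball.isCompact_closure)).mono_set subset_closure
  rw [integral_neg] at hpos
  linarith

end Affine

end Radial

/-! ### Growth and localization of the sampled function. -/

/-- Positivity of the moment functional of the sequence `φ (s + n t)` on polynomials
nonnegative on some interval `[0, R]` depending only on `t`. -/
def HasStieltjesSamples (φ : ℝ → ℝ) : Prop :=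
  ∀ t : ℝ, 0 ≤ t → ∃ R : ℝ, 0 ≤ R ∧ ∀ p : Polynomial ℝ, (∀ x ∈ Icc 0 R, 0 ≤ p.eval x) →
    ∀ s : ℝ, 0 ≤ momentFunctional (fun n => φ (s + n * t)) p

open Polynomial Filter Topology

theorem HasStieltjesSamples.exists_le_exp {φ : ℝ → ℝ} (h : HasStieltjesSamples φ)
    (hc : Continuous φ) (heven : ∀ x, φ (-x) = φ x) (hpos : ∀ x, 0 < φ x) :
    ∃ C K : ℝ, 0 ≤ C ∧ 0 ≤ K ∧ ∀ x, φ x ≤ C * Real.exp (K * |x|) := by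
  obtain ⟨R, hR, hp⟩ := h 1 zero_le_one
  have hstep : ∀ (s : ℝ) (n : ℕ), φ (s + n) ≤ R ^ n * φ s := by
    intro s n
    have h1 := hp (C (R ^ n) - X ^ n) (fun x hx => by
      simpa using pow_le_pow_left₀ hx.1 hx.2 n) s
    rw [map_sub, momentFunctional_C, momentFunctional_X_pow] at h1
    simpa using h1
  obtain ⟨B, hB⟩ := (isCompact_Icc (a := (0 : ℝ)) (b := 1)).bddAbove_image hc.continuousOn
  have hB' : ∀ x ∈ Icc (0 : ℝ) 1, φ x ≤ B := fun x hx => hB ⟨x, hx, rfl⟩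
  have hB0 : 0 ≤ B := (hpos 0).le.trans (hB' 0 (by simp))
  refine ⟨B, Real.log (max R 1), hB0, Real.log_nonneg (le_max_right _ _), fun x => ?_⟩
  have hx : φ x = φ |x| := by
    rcases abs_cases x with ⟨h, _⟩ | ⟨h, _⟩ <;> rw [h]
    exact (heven x).symm
  have h1 : (1 : ℝ) ≤ max R 1 := le_max_right _ _
  have hfl := Nat.floor_le (abs_nonneg x)
  have hlt := Nat.lt_floor_add_one |x|
  rw [hx]
  calc φ |x| = φ ((|x| - ⌊|x|⌋₊) + ⌊|x|⌋₊) := by rw [sub_add_cancel]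
    _ ≤ R ^ ⌊|x|⌋₊ * φ (|x| - ⌊|x|⌋₊) := hstep _ _
    _ ≤ (max R 1) ^ ⌊|x|⌋₊ * B := by
        gcongr
        · exact (hpos _).le
        · exact le_max_left _ _
        · exact hB' _ ⟨by linarith, by linarith⟩
    _ = B * (max R 1) ^ (⌊|x|⌋₊ : ℝ) := by rw [mul_comm, Real.rpow_natCast]
    _ ≤ B * (max R 1) ^ |x| := by gcongr
    _ = B * Real.exp (Real.log (max R 1) * |x|) := by
        rw [Real.rpow_def_of_pos (by linarith)]

theorem tendsto_inv_exp_pow_mul {φ : ℝ → ℝ} (hpos : ∀ x, 0 < φ x) {C K L t : ℝ} (hKL : K < L)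
    (hK : 0 ≤ K) (hC : 0 ≤ C)
    (ht : 0 < t) (hφ : ∀ x, φ x ≤ C * Real.exp (K * |x|)) (s : ℝ) {σ : ℝ} (hσ : |σ| = 1) :
    Tendsto (fun n : ℕ => (Real.exp (-(L * t))) ^ n * φ (s + σ * (n * t))) atTop (𝓝 0) := by
  have hlim : Tendsto (fun n : ℕ => C * Real.exp (K * |s|) * (Real.exp (-((L - K) * t))) ^ n)
      atTop (𝓝 0) := by
    have h0 : Real.exp (-((L - K) * t)) < 1 := by
      rw [Real.exp_lt_one_iff]; nlinarith
    simpa using (tendsto_pow_atTop_nhds_zero_of_lt_one (Real.exp_pos _).le h0).const_mul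
      (C * Real.exp (K * |s|))
  refine squeeze_zero (fun n => by have := hpos (s + σ * (n * t)); positivity) (fun n => ?_) hlim
  have habs : |s + σ * (n * t)| ≤ |s| + n * t := by
    refine (abs_add_le _ _).trans ?_
    rw [abs_mul, hσ, one_mul, abs_of_nonneg (by positivity : (0 : ℝ) ≤ n * t)]
  calc _ ≤ (Real.exp (-(L * t))) ^ n * (C * Real.exp (K * (|s| + n * t))) := by
        gcongr
        refine (hφ _).trans ?_
        gcongr
    _ = _ := by
        rw [← Real.exp_nat_mul, ← Real.exp_nat_mul, mul_comm, mul_assoc, mul_assoc, ← Real.exp_add,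
          ← Real.exp_add]
        ring_nf

/-- The a priori interval `[0, R]` depends on `t`; positivity on `[e^{-Lt}, e^{Lt}]` suffices
because `φ` grows more slowly than `e^{L|x|}` in both directions. -/
theorem HasStieltjesSamples.momentFunctional_nonneg {φ : ℝ → ℝ} (h : HasStieltjesSamples φ)
    (hpos : ∀ x, 0 < φ x) {C K L : ℝ} (hKL : K < L) (hK : 0 ≤ K) (hC : 0 ≤ C)
    (hφ : ∀ x, φ x ≤ C * Real.exp (K * |x|)) {t : ℝ} (ht : 0 < t) {p : ℝ[X]}
    (hp : ∀ x ∈ Icc (-L) L, 0 ≤ p.eval (Real.exp (t * x))) (s : ℝ) :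
    0 ≤ momentFunctional (fun n => φ (s + n * t)) p := by
  obtain ⟨R, hR, hpR⟩ := h t ht.le
  obtain ⟨B, hB⟩ := (isCompact_Icc (a := (0 : ℝ)) (b := R)).exists_bound_of_continuousOn
    p.continuous.continuousOn
  have hB0 : 0 ≤ B := (norm_nonneg _).trans (hB 0 ⟨le_rfl, hR⟩)
  set r : ℝ := Real.exp (-(L * t)) with hr
  have hr0 : 0 < r := Real.exp_pos _
  have hmain : ∀ m : ℕ, 0 ≤ momentFunctional (fun n => φ (s + n * t)) p +
      B * (r ^ m * φ (s + 1 * (m * t))) + B * (r ^ m * φ (s + (-1) * (m * t))) := by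
    intro m
    -- With `p ≥ -B` on `[0, R]`, the constant term compensates for `x < r` and the `X ^ (2m)` term
    -- for `x > 1/r`. Starting the samples at `s - m t` recentres `X ^ m * p` at `s`; the
    -- corrections become `B rᵐ φ(s ± m t)`, which tend to `0`.
    have h1 := hpR (X ^ m * (p + Polynomial.C (B * r ^ m) * X ^ m) + Polynomial.C (B * r ^ m)) (fun x hx => by
      have hx0 := hx.1
      have hBx := (abs_le.1 (hB x hx)).1
      simp only [eval_add, eval_mul, eval_pow, eval_X, eval_C]
      rcases lt_or_ge x r with hxr | hxr
      · have h2 : x ^ m ≤ r ^ m := pow_le_pow_left₀ hx0 hxr.le m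
        have h3 : 0 ≤ x ^ m := by positivity
        have h4 : 0 ≤ B * r ^ m * x ^ m := by positivity
        have h5 : x ^ m * (-B) ≤ x ^ m * (p.eval x + B * r ^ m * x ^ m) := by
          gcongr; linarith
        nlinarith
      · have hxpos : 0 < x := hr0.trans_le hxr
        suffices 0 ≤ p.eval x + B * r ^ m * x ^ m by positivity
        rcases le_or_gt (r * x) 1 with hrx | hrx
        · have h2 : Real.exp (t * (Real.log x / t)) = x := by
            rw [mul_div_cancel₀ _ ht.ne', Real.exp_log hxpos]
          have h3 := hp (Real.log x / t) ⟨by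
            rw [le_div_iff₀ ht, Real.le_log_iff_exp_le hxpos]; simpa [hr] using hxr, by
            rw [div_le_iff₀ ht, Real.log_le_iff_le_exp hxpos]
            rw [hr, Real.exp_neg, inv_mul_le_iff₀ (Real.exp_pos _), mul_one] at hrx
            exact hrx⟩
          rw [h2] at h3
          positivity
        · have h2 : 1 ≤ r ^ m * x ^ m := by
            rw [← mul_pow]; exact one_le_pow₀ hrx.le
          nlinarith) (s - m * t)
    rw [map_add, momentFunctional_X_pow_mul, map_add, momentFunctional_C_mul,
      momentFunctional_X_pow, momentFunctional_C] at h1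
    have e1 : ∀ n : ℕ, s - m * t + ((n + m : ℕ) : ℝ) * t = s + n * t := by
      intro n; push_cast; ring
    simp only [e1] at h1
    have e2 : s - m * t + ((0 : ℕ) : ℝ) * t = s + (-1) * (m * t) := by push_cast; ring
    rw [e2] at h1
    rw [one_mul]
    linarith
  have hlim : Tendsto (fun m : ℕ => momentFunctional (fun n => φ (s + n * t)) p +
      B * (r ^ m * φ (s + 1 * (m * t))) + B * (r ^ m * φ (s + (-1) * (m * t)))) atTop
      (𝓝 (momentFunctional (fun n => φ (s + n * t)) p + B * 0 + B * 0)) :=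
    (tendsto_const_nhds.add
      ((tendsto_inv_exp_pow_mul hpos hKL hK hC ht hφ s (by simp)).const_mul B)).add
      ((tendsto_inv_exp_pow_mul hpos hKL hK hC ht hφ s (by simp)).const_mul B)
  simpa using ge_of_tendsto' hlim hmain

/-! ### Exponential sums and the representing measure. -/

open Polynomial Filter Topology

/-- The exponential sum `x ↦ ∑ q, c q * exp (q x)` restricted to `[-L, L]`. -/
noncomputable def expSum (L : ℝ) : (ℚ →₀ ℝ) →ₗ[ℝ] C(Icc (-L) L, ℝ) :=
  Finsupp.linearCombination ℝ fun q : ℚ =>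
    (⟨fun x => Real.exp (q * x), by fun_prop⟩ : C(Icc (-L) L, ℝ))

theorem expSum_apply (L : ℝ) (c : ℚ →₀ ℝ) (x : Icc (-L) L) :
    expSum L c x = ∑ q ∈ c.support, c q * Real.exp (q * x) := by
  simp [expSum, Finsupp.linearCombination_apply, Finsupp.sum, ContinuousMap.sum_apply]

theorem expSum_single (L : ℝ) (q : ℚ) (a : ℝ) (x : Icc (-L) L) :
    expSum L (Finsupp.single q a) x = a * Real.exp (q * x) := by
  simp [expSum]

/-- Makes a rational exponential sum equal to `e^{-Mx}` times a polynomial in `e^{x/N}`. -/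
theorem Finset.exists_common_denominator (s : Finset ℚ) :
    ∃ (N M : ℕ), 0 < N ∧ ∃ e : ℚ → ℕ, ∀ q ∈ s, (q : ℝ) = -M + e q * (1 / N : ℝ) := by
  refine ⟨∏ q ∈ s, q.den, ∑ q ∈ s, q.num.natAbs, Finset.prod_pos fun q _ => q.den_pos,
    fun q => ((q + (∑ q ∈ s, q.num.natAbs : ℕ)) * (∏ q ∈ s, q.den : ℕ)).num.toNat, fun q hq => ?_⟩
  set M := ∑ q ∈ s, q.num.natAbs
  set N := ∏ q ∈ s, q.den with hN
  have hN0 : 0 < N := Finset.prod_pos fun q _ => q.den_pos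
  have hqM : 0 ≤ q + (M : ℚ) := by
    have h1 : q.num.natAbs ≤ M := Finset.single_le_sum (f := fun q : ℚ => q.num.natAbs)
      (fun _ _ => Nat.zero_le _) hq
    have h2 : |q| ≤ (q.num.natAbs : ℚ) := by
      have h3 : |q| * q.den = (q.num.natAbs : ℚ) := by
        rw [Nat.cast_natAbs, Int.cast_abs, ← Rat.mul_den_eq_num q, abs_mul, Nat.abs_cast]
      rw [← h3]
      exact le_mul_of_one_le_right (abs_nonneg _) (by exact_mod_cast q.den_pos)
    have h4 : (q.num.natAbs : ℚ) ≤ M := by exact_mod_cast h1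
    linarith [neg_abs_le q]
  obtain ⟨k, hk⟩ : q.den ∣ N := Finset.dvd_prod_of_mem _ hq
  obtain ⟨z, hz⟩ : ∃ z : ℤ, (q + (M : ℚ)) * (N : ℚ) = z := by
    refine ⟨q.num * k + M * N, ?_⟩
    have : q * N = q.num * k := by
      rw [hk]; push_cast; rw [← mul_assoc, Rat.mul_den_eq_num]
    push_cast
    linear_combination this
  have hz0 : 0 ≤ z := by
    have : (0 : ℚ) ≤ z := by rw [← hz]; positivity
    exact_mod_cast this
  obtain ⟨n, rfl⟩ := Int.eq_ofNat_of_zero_le hz0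
  have hN' : (N : ℝ) ≠ 0 := by positivity
  have hz' : ((q : ℝ) + M) * N = n := by exact_mod_cast hz
  simp only [hz, Int.cast_natCast, Rat.num_natCast, Int.toNat_natCast]
  rw [← hz']
  field_simp
  ring

theorem HasStieltjesSamples.linearCombination_nonneg {φ : ℝ → ℝ} (h : HasStieltjesSamples φ)
    (hpos : ∀ x, 0 < φ x) {C K L : ℝ} (hKL : K < L) (hK : 0 ≤ K) (hC : 0 ≤ C)
    (hφ : ∀ x, φ x ≤ C * Real.exp (K * |x|)) {c : ℚ →₀ ℝ} (hc : ∀ x, 0 ≤ expSum L c x) :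
    0 ≤ Finsupp.linearCombination ℝ (fun q : ℚ => φ q) c := by
  obtain ⟨N, M, hN, e, he⟩ := c.support.exists_common_denominator
  have hNr : (0 : ℝ) < 1 / N := by positivity
  have h1 := h.momentFunctional_nonneg hpos hKL hK hC hφ hNr
    (p := ∑ q ∈ c.support, monomial (e q) (c q)) (fun x hx => by
      have h2 : Real.exp (M * x) * expSum L c ⟨x, hx⟩ =
          eval (Real.exp (1 / N * x)) (∑ q ∈ c.support, monomial (e q) (c q)) := by
        rw [expSum_apply, eval_finsetSum, Finset.mul_sum]
        refine Finset.sum_congr rfl fun q hq => ?_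
        rw [eval_monomial, ← Real.exp_nat_mul, mul_left_comm, ← Real.exp_add]
        congr 2
        rw [he q hq]
        ring
      rw [← h2]
      exact mul_nonneg (Real.exp_pos _).le (hc _)) (-M)
  rw [map_sum] at h1
  rw [Finsupp.linearCombination_apply, Finsupp.sum]
  refine h1.trans_eq (Finset.sum_congr rfl fun q hq => ?_)
  rw [momentFunctional_monomial, ← he q hq, smul_eq_mul]

/-- A positive linear functional along a linear map into `C(X, ℝ)` whose range contains a
positive constant is represented by a finite measure. -/
theorem exists_measure_integral_eq_of_nonneg {X : Type*} [TopologicalSpace X] [CompactSpace X]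
    [T2Space X] [MeasurableSpace X] [BorelSpace X] {V : Type*} [AddCommGroup V] [Module ℝ V]
    (ev : V →ₗ[ℝ] C(X, ℝ)) (ℓ : V →ₗ[ℝ] ℝ) (hℓ : ∀ c, 0 ≤ ev c → 0 ≤ ℓ c)
    {u : V} (hu : ev u = 1) :
    ∃ μ : Measure X, IsFiniteMeasure μ ∧ ∀ c, ℓ c = ∫ x, ev c x ∂μ := by
  let T : V × C(X, ℝ) →ₗ[ℝ] C(X, ℝ) := ev.coprod LinearMap.id
  -- Extending from `V × 0` to `V × C(X, ℝ)` avoids factoring `ℓ` through the range of `ev`.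
  let s : PointedCone ℝ (V × C(X, ℝ)) := (PointedCone.positive ℝ C(X, ℝ)).comap T
  have hs : ∀ y, y ∈ s ↔ 0 ≤ ev y.1 + y.2 := fun y => by
    simp [s, T, PointedCone.mem_comap]
  let f : V × C(X, ℝ) →ₗ.[ℝ] ℝ :=
    ⟨LinearMap.ker (LinearMap.snd ℝ V C(X, ℝ)), ℓ ∘ₗ (LinearMap.fst ℝ V C(X, ℝ)).domRestrict _⟩
  obtain ⟨g, hg, hgs⟩ := riesz_extension s f (fun x hx => by
      have hx2 : x.1.2 = 0 := x.2
      rw [hs, hx2, add_zero] at hx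
      exact hℓ _ hx) (fun y => by
      refine ⟨⟨(‖ev y.1 + y.2‖ • u, 0), rfl⟩, ?_⟩
      rw [hs, Prod.fst_add, Prod.snd_add, zero_add, map_add, map_smul, hu, add_assoc]
      refine ContinuousMap.le_def.2 fun x => ?_
      have h1 := neg_abs_le ((ev y.1 + y.2) x)
      have h2 := ContinuousMap.norm_coe_le_norm (ev y.1 + y.2) x
      rw [Real.norm_eq_abs] at h2
      rw [ContinuousMap.add_apply, ContinuousMap.smul_apply, ContinuousMap.one_apply,
        ContinuousMap.zero_apply, smul_eq_mul, mul_one]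
      linarith)
  let Λ₀ : CompactlySupportedContinuousMap X ℝ →ₗ[ℝ] ℝ :=
    { toFun := fun F => g (0, (F : C(X, ℝ)))
      map_add' := fun F G => by
        rw [← map_add]; congr 1; ext <;> simp
      map_smul' := fun a F => by
        rw [RingHom.id_apply, ← map_smul]; congr 1; ext <;> simp }
  let Λ : CompactlySupportedContinuousMap X ℝ →ₚ[ℝ] ℝ :=
    PositiveLinearMap.mk₀ Λ₀ (fun F hF => hgs _ (by
      rw [hs, map_zero, zero_add]
      exact ContinuousMap.le_def.2 fun x => hF x))
  refine ⟨RealRMK.rieszMeasure Λ, inferInstance, fun c => ?_⟩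
  have h1 := RealRMK.integral_rieszMeasure Λ (CompactlySupportedContinuousMap.continuousMapEquiv (ev c))
  have h2 : Λ (CompactlySupportedContinuousMap.continuousMapEquiv (ev c)) = g (0, ev c) := rfl
  have h3 : g (c, 0) = ℓ c := hg ⟨(c, 0), rfl⟩
  have h4 : 0 ≤ g (c, - ev c) := hgs _ (by rw [hs]; simp)
  -- Both `(c, -ev c)` and its negative lie in the cone, so `g (c, 0) = g (0, ev c)`.
  have h5 : 0 ≤ g (-c, ev c) := hgs _ (by rw [hs]; simp)
  have h6 : g (c, - ev c) = g (c, 0) - g (0, ev c) := by rw [← map_sub]; simp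
  have h7 : g (-c, ev c) = g (0, ev c) - g (c, 0) := by rw [← map_sub]; simp
  rw [h2] at h1
  simp only [CompactlySupportedContinuousMap.continuousMapEquiv_apply_toFun] at h1
  refine Eq.trans ?_ h1.symm
  linarith

theorem HasStieltjesSamples.exists_coshTransform {φ : ℝ → ℝ} (h : HasStieltjesSamples φ)
    (hcont : Continuous φ) (heven : ∀ x, φ (-x) = φ x) (hpos : ∀ x, 0 < φ x) :
    ∃ ν : Measure ℝ≥0, IsCompactlySupported ν ∧ IsCoshTransform φ ν := by
  obtain ⟨C, K, hC, hK, hφ⟩ := h.exists_le_exp hcont heven hpos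
  have hKL : K < K + 1 := lt_add_one K
  set L := K + 1
  obtain ⟨μ, _, hμ⟩ := exists_measure_integral_eq_of_nonneg (expSum L)
    (Finsupp.linearCombination ℝ (fun q : ℚ => φ q))
    (fun c hc => h.linearCombination_nonneg hpos hKL hK hC hφ hc) (u := Finsupp.single 0 1)
    (by ext x; rw [expSum_single]; simp)
  have hint : ∀ x : ℝ, φ x = ∫ u : Icc (-L) L, Real.exp (x * u) ∂μ := by
    have hcont' : Continuous fun x : ℝ => ∫ u : Icc (-L) L, Real.exp (x * u) ∂μ := by
      rw [← continuousOn_univ, ← Measure.restrict_univ (μ := μ)]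
      exact continuousOn_integral_of_compact_support isCompact_univ (by fun_prop) (by simp)
    -- Both sides are continuous, so agreement at rationals suffices.
    refine fun x => congrFun (Rat.denseRange_cast.equalizer hcont hcont' (funext fun q => ?_)) x
    have := hμ (Finsupp.single q 1)
    simpa [expSum_single] using this
  have hintble : ∀ g : Icc (-L) L → ℝ, Continuous g → Integrable g μ := fun g hg =>
    hg.integrable_of_hasCompactSupport (HasCompactSupport.of_compactSpace g)
  let N : Icc (-L) L → ℝ≥0 := fun u => ‖(u : ℝ)‖₊
  have hN : Continuous N := by fun_prop
  have hcosh : ∀ x : ℝ, ∀ u : Icc (-L) L,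
      Real.cosh (x * (N u : ℝ)) = (Real.exp (x * u) + Real.exp (-x * u)) / 2 := by
    intro x u
    rw [neg_mul, ← Real.cosh_eq, ← Real.cosh_abs, abs_mul, ← Real.cosh_abs (x * u), abs_mul]
    simp [N]
  refine ⟨μ.map N, ⟨Icc 0 (Real.toNNReal L), isCompact_Icc, ?_⟩, fun x => ⟨?_, ?_⟩⟩
  · rw [Measure.map_apply hN.measurable measurableSet_Icc.compl]
    convert measure_empty (μ := μ)
    ext u
    have h1 : |(u : ℝ)| ≤ L := abs_le.2 u.2
    simp only [mem_preimage, mem_compl_iff, mem_Icc, zero_le, true_and, mem_empty_iff_false,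
      iff_false, not_not]
    rw [← NNReal.coe_le_coe, Real.coe_toNNReal _ (by positivity)]
    simpa [N] using h1
  · rw [integrable_map_measure (by fun_prop) hN.aemeasurable]
    exact hintble _ (by fun_prop)
  · rw [integral_map hN.aemeasurable (by fun_prop)]
    simp only [hcosh]
    rw [integral_div, integral_add (hintble _ (by fun_prop)) (hintble _ (by fun_prop)), ← hint,
      ← hint, heven]
    ring

/-! ### Restriction to the fixed line and conclusion. -/

theorem iterate_linearMap_add_const_of_fixed {V : Type*} [AddCommGroup V] [Module ℝ V]
    {A : V →ₗ[ℝ] V} {a : V} (ha : A a = a) (s t : ℝ) (n : ℕ) :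
    (fun x => A x + t • a)^[n] (s • a) = (s + n * t) • a := by
  induction n with
  | zero => simp
  | succ n ih =>
    rw [Function.iterate_succ_apply', ih, map_smul, ha, ← add_smul]
    push_cast
    ring_nf

theorem proposition3p2p4 (κ : ℕ) (ψ : ℝ → ℝ)
    (hψ_pos : ∀ x, 0 < ψ x) (hψ_cont : Continuous ψ) (hψ_even : ∀ x, ψ (-x) = ψ x)
    (A : EuclideanSpace ℝ (Fin κ) →ₗ[ℝ] EuclideanSpace ℝ (Fin κ)) (hA : IsUnit A)
    (a₀ : EuclideanSpace ℝ (Fin κ)) (ha₀ : a₀ ∈ LinearMap.ker (LinearMap.id - A))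
    (ha₀_ne : a₀ ≠ 0)
    (hbdd : ∀ t : ℝ, 0 ≤ t →
      HasBoundedCompositionOp (radialMeasure κ ψ) (fun x => A x + t • a₀))
    (hcosub : ∀ t : ℝ, 0 ≤ t →
      IsCosubnormalOp (compositionOp (radialMeasure κ ψ) (fun x => A x + t • a₀)))
    (hsup : ∃ ε : ℝ, 0 < ε ∧
      BddAbove ((fun t : ℝ => ‖compositionOp (radialMeasure κ ψ) (fun x => A x + t • a₀)‖) ''
        Set.Icc 0 ε)) :
    ∃ ν : Measure ℝ≥0, IsCompactlySupported ν ∧ IsCoshTransform ψ ν := by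
  have hfix : A a₀ = a₀ := by
    rw [LinearMap.mem_ker, LinearMap.sub_apply, LinearMap.id_apply, sub_eq_zero] at ha₀
    exact ha₀.symm
  have hnorm : 0 < ‖a₀‖ := norm_pos_iff.2 ha₀_ne
  refine HasStieltjesSamples.exists_coshTransform (fun t ht => ?_) hψ_cont hψ_even hψ_pos
  -- Dividing by `‖a₀‖` makes the samples along the line exactly `ψ(s + n t)`; evenness absorbs the
  -- sign lost in the norm.
  have ht' : 0 ≤ t / ‖a₀‖ := by positivity
  obtain ⟨R, hR, h⟩ := exists_momentFunctional_iterate_nonneg ((t / ‖a₀‖) • a₀) hψ_pos hψ_cont hA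
    (hbdd _ ht') (hcosub _ ht')
  refine ⟨R, hR, fun p hp s => ?_⟩
  have hs := h p hp ((s / ‖a₀‖) • a₀)
  have heq : ∀ n : ℕ, ψ ‖(s / ‖a₀‖ + n * (t / ‖a₀‖)) • a₀‖ = ψ (s + n * t) := by
    intro n
    have h1 : (s / ‖a₀‖ + n * (t / ‖a₀‖)) * ‖a₀‖ = s + n * t := by field_simp
    rw [norm_smul, Real.norm_eq_abs, ← abs_of_pos hnorm, ← abs_mul, abs_of_pos hnorm, h1]
    rcases abs_choice (s + n * t) with h2 | h2 <;> rw [h2]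
    exact hψ_even _
  simpa only [iterate_linearMap_add_const_of_fixed hfix, heq] using hs
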